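/- For a finite field $\mathbb{F}_q$ with $q$ elements, positive integers $k<n$ and a vector $\vec\alpha=(\alpha_1,\dots,\alpha_n)\in\mathbb{F}_q^n$ with pairwise distinct coordinates (an evaluation vector), the $[n,k]$-RS code defined by $\vec\alpha$ is $\{(f(\alpha_1),\dots,f(\alpha_n)) : f\in\mathbb{F}_q[x],\ \deg f<k\}$. The rate of a code $\mathcal{C}\subseteq\mathbb{F}_q^n$ is $R=\frac{1}{n}\log_q|\mathcal{C}|$, which is $k/n$ for an $[n,k]$-RS code. The code $\mathcal{C}$ is $(r,L)$ list-decodable if for every $\vec y\in\mathbb{F}_q^n$ at most $L$ codewords of $\mathcal{C}$ are at Hamming distance at most $rn$ from $\vec y$. Theorem. Let $n>k$ be positive integers. (1) There is a constant $c_3=c_3(n,k)$ such that for every prime power $q$, all but at most $c_3\,q^{n-1}$ vectors of $\mathbb{F}_q^n$ have pairwise distinct coordinates and define an $[n,k]$-RS code which is $\left(\frac34(1-R),3\right)$ list-decodable. (2) Consequently, if $k/n>\frac19$, then most $[n,k]$-RS codes over large fields are list-decodable beyond the Johnson radius $1-\sqrt R$: there is a constant $c=c(n,k)$ such that for every prime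 power $q$, at least a $\left(1-\frac{c}{q}\right)$-fraction of the vectors of $\mathbb{F}_q^n$ with pairwise distinct coordinates (that is, at least $\left(1-\frac{c}{q}\right)$ times their number) define an $[n,k]$-RS code for which $\frac34(1-R)>1-\sqrt R$ and which is $\left(\frac34(1-R),3\right)$ list-decodable. -/

import Mathlib

open Polynomial

universe u

noncomputable section

/-- The closed Hamming ball of (real, absolute) radius `ρ` around `y` in `Q ^ n`. -/
def codeBall {Q : Type*} [DecidableEq Q] {n : ℕ} (y : Fin n → Q) (ρ : ℝ) : Set (Fin n → Q) :=
  {c | (hammingDist y c : ℝ) ≤ ρ}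

/-- A code `C ⊆ Q ^ n` is (combinatorially) `(r, L)` list-decodable if every Hamming ball of
radius `r n` in `Q ^ n` contains at most `L` codewords of `C`. -/
def IsListDecodable {Q : Type*} [DecidableEq Q] {n : ℕ} (C : Set (Fin n → Q))
    (r : ℝ) (L : ℕ) : Prop :=
  ∀ y : Fin n → Q, (codeBall y (r * n) ∩ C).encard ≤ L

/-- The rate `log_q |C| / n` of a code `C ⊆ Q ^ n` over an alphabet of size `q = |Q|`. -/
def codeRate {Q : Type*} [Fintype Q] {n : ℕ} (C : Set (Fin n → Q)) : ℝ :=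
  Real.logb (Fintype.card Q) C.ncard / n

/-- The set of all `(f (α₁), …, f (αₙ))` with `f ∈ F[X]`, `deg f < k`. For `α` with pairwise
distinct coordinates this is the `[n, k]` Reed-Solomon code defined by the evaluation
vector `α`. -/
def rsCode {F : Type*} [Field F] {n : ℕ} (k : ℕ) (α : Fin n → F) : Set (Fin n → F) :=
  {c | ∃ f : F[X], f.degree < k ∧ ∀ i, c i = f.eval (α i)}

/-- The Johnson radius `1 - √R` for Reed-Solomon codes of rate `R`. -/
def johnsonRadius (R : ℝ) : ℝ := 1 - Real.sqrt R

/-- The radius `(3/4)(1 - R)`, where `R` is the rate of the code `C`. -/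
def radiusThree {Q : Type*} [Fintype Q] {n : ℕ} (C : Set (Fin n → Q)) : ℝ :=
  3 / 4 * (1 - codeRate C)

end

noncomputable section

/-! Put m = n - k. If list decoding fails, four distinct polynomials of degree below k agree with
one word y off error sets A 0, ..., A 3 of size at most 3m/4. The dual of the code is a generalized
Reed-Solomon code of polynomials of degree below m, and those vanishing on A i do not see the errors
of the i-th polynomial, hence annihilate y. Suppose that, for some subfamily of at least two sets,
such polynomials span everything vanishing on the intersection. Then y satisfies so many checks that
all message polynomials of the subfamily coincide, a contradiction (`IndepMultiples.eq_of_agree`).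

Since the codimensions m - |A i| add up to at least m, a minimal subfamily has the right dimension
count (`exists_isAdmissible`), and the GM-MDS theorem turns this count into linear independence for
generic evaluation points (`IsAdmissible.exists_indepMultiples`). The count is a necessary
condition: the multiples indexed by I share the common roots and the factor X to the least
multiplicity, which is what "some i in I" expresses in `bound`. The root 0 is set apart so that
other roots can be specialized to it in an induction.

Independence is certified by a nonzero polynomial whose degree is bounded in terms of n alone.
Multiplying over all quadruples of error sets and applying Schwartz-Zippel bounds the bad vectors by
a constant times q^(n-1). -/

/-- The polynomial `X ^ t * ∏ j ∈ A, (X - a j)`. -/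
def rootProduct {K σ : Type*} [Field K] (a : σ → K) (A : Finset σ) (t : ℕ) : K[X] :=
  X ^ t * ∏ j ∈ A, (X - C (a j))

/-- The multiples `p i * rootProduct a (A i) (t i)` with `deg (p i) < d i`, `i ∈ S`, are
linearly independent. -/
def IndepMultiples {K σ ι : Type*} [Field K] (S : Finset ι) (A : ι → Finset σ) (t d : ι → ℕ)
    (a : σ → K) : Prop :=
  ∀ p : ι → K[X], (∀ i ∈ S, (p i).degree < d i) →
    ∑ i ∈ S, p i * rootProduct a (A i) (t i) = 0 → ∀ i ∈ S, p i = 0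

/-- The combinatorial condition of the GM-MDS theorem, for polynomials of degree less than `k`
with one distinguished root `0` of arbitrary multiplicity. -/
structure IsAdmissible {σ ι : Type*} [Fintype σ] [DecidableEq σ] (k : ℕ) (S : Finset ι)
    (A : ι → Finset σ) (t d : ι → ℕ) : Prop where
  size : ∀ i ∈ S, (A i).card + t i + d i = k
  bound : ∀ I ⊆ S, I.Nonempty → ∃ i ∈ I, ∑ l ∈ I, d l + (I.inf A).card + t i ≤ k

/-! ### Products of linear factors: degrees, divisibility, specialization of a root. -/

section RootProduct

variable {K σ : Type*} [Field K]

theorem rootProduct_monic (a : σ → K) (A : Finset σ) (t : ℕ) : (rootProduct a A t).Monic :=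
  (monic_X_pow t).mul (monic_prod_of_monic _ _ fun j _ => monic_X_sub_C (a j))

theorem rootProduct_ne_zero (a : σ → K) (A : Finset σ) (t : ℕ) : rootProduct a A t ≠ 0 :=
  (rootProduct_monic a A t).ne_zero

theorem natDegree_rootProduct (a : σ → K) (A : Finset σ) (t : ℕ) :
    (rootProduct a A t).natDegree = A.card + t := by
  rw [rootProduct, (monic_X_pow t).natDegree_mul
    (monic_prod_of_monic _ _ fun j _ => monic_X_sub_C (a j)),
    natDegree_prod_of_monic _ _ fun j _ => monic_X_sub_C (a j)]
  simp [add_comm]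

theorem degree_rootProduct (a : σ → K) (A : Finset σ) (t : ℕ) :
    (rootProduct a A t).degree = (A.card + t : ℕ) := by
  rw [degree_eq_natDegree (rootProduct_ne_zero a A t), natDegree_rootProduct]

theorem degree_mul_rootProduct_lt_iff (a : σ → K) (A : Finset σ) (t d : ℕ) (p : K[X]) :
    (p * rootProduct a A t).degree < (A.card + t + d : ℕ) ↔ p.degree < d := by
  rcases eq_or_ne p 0 with rfl | hp
  · simp
  · rw [degree_mul, degree_rootProduct, degree_eq_natDegree hp]
    norm_cast
    omega

theorem rootProduct_succ (a : σ → K) (A : Finset σ) (t : ℕ) :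
    rootProduct a A (t + 1) = X * rootProduct a A t := by
  rw [rootProduct, rootProduct]; ring

theorem rootProduct_eq_mul_of_subset [DecidableEq σ] (a : σ → K) {A B : Finset σ} (hBA : B ⊆ A)
    {s t : ℕ} (hst : s ≤ t) :
    rootProduct a A t = rootProduct a (A \ B) (t - s) * rootProduct a B s := by
  rw [rootProduct, rootProduct, rootProduct, ← Finset.prod_sdiff hBA, ← pow_sub_mul_pow X hst]
  exact mul_mul_mul_comm _ _ _ _

theorem eval_rootProduct (a : σ → K) (A : Finset σ) (t : ℕ) (x : K) :
    (rootProduct a A t).eval x = x ^ t * ∏ j ∈ A, (x - a j) := by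
  simp [rootProduct, eval_prod]

theorem rootProduct_update_zero [DecidableEq σ] (a : σ → K) (A : Finset σ) (t : ℕ) (j : σ) :
    rootProduct (Function.update a j 0) A t =
      rootProduct a (A.erase j) (t + if j ∈ A then 1 else 0) := by
  have h : ∏ x ∈ A.erase j, (X - C (Function.update a j 0 x)) =
      ∏ x ∈ A.erase j, (X - C (a x)) :=
    Finset.prod_congr rfl fun x hx => by
      rw [Function.update_of_ne (Finset.ne_of_mem_erase hx)]
  rw [rootProduct, rootProduct, ← h]
  split_ifs with hj
  · rw [← Finset.mul_prod_erase _ _ hj]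
    simp [pow_succ, mul_assoc]
  · rw [Finset.erase_eq_of_notMem hj, add_zero]

theorem map_rootProduct {L : Type*} [Field L] (φ : K →+* L) (a : σ → K) (A : Finset σ) (t : ℕ) :
    (rootProduct a A t).map φ = rootProduct (fun j => φ (a j)) A t := by
  simp [rootProduct, Polynomial.map_prod]

end RootProduct

/-! ### Independence as the nonvanishing of a polynomial in the roots. -/

section Openness

variable {K σ ι : Type*} [Field K]

/-- Independence of the multiples at one point is an open condition: it is certified by a
polynomial in the point, whose degree is bounded by the combinatorial data alone. -/
theorem IndepMultiples.exists_certificate [Infinite K] [Fintype σ] {S : Finset ι}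
    {A : ι → Finset σ} {t d : ι → ℕ} {k : ℕ} (hk : ∀ i ∈ S, (A i).card + t i + d i ≤ k)
    {a₀ : σ → K} (h : IndepMultiples S A t d a₀) :
    ∃ D : MvPolynomial σ K, D ≠ 0 ∧ D.totalDegree ≤ (∑ i ∈ S, d i) * Fintype.card σ ∧
      ∀ a : σ → K, MvPolynomial.eval a D ≠ 0 → IndepMultiples S A t d a := by
  classical
  let T := Σ i : S, Fin (d i)
  -- All sums involved have degree below k, so their values at k fixed distinct points determine
  -- them.
  let x : Fin k → K := fun c => Infinite.natEmbedding K c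
  have hx : Function.Injective x := (Infinite.natEmbedding K).injective.comp Fin.val_injective
  -- Row (i, e) holds the values at these points of X^e times the i-th product, with the roots as
  -- indeterminates; independence means that the rows are independent.
  let M : Matrix T (Fin k) (MvPolynomial σ K) := fun s c =>
    MvPolynomial.C (x c ^ (s.2 + t s.1 : ℕ)) *
      ∏ j ∈ A s.1, (MvPolynomial.C (x c) - MvPolynomial.X j)
  let Ma : (σ → K) → Matrix T (Fin k) K := fun a => M.map (MvPolynomial.eval a)
  let P : (T → K) → ι → K[X] := fun w i =>
    if hi : i ∈ S then ∑ e : Fin (d i), C (w ⟨⟨i, hi⟩, e⟩) * X ^ (e : ℕ) else 0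
  have hvec : ∀ a w c, Matrix.vecMul w (Ma a) c =
      (∑ i ∈ S, P w i * rootProduct a (A i) (t i)).eval (x c) := by
    intro a w c
    rw [← Finset.sum_coe_sort S, eval_finsetSum, Matrix.vecMul, dotProduct, Fintype.sum_sigma]
    refine Finset.sum_congr rfl fun i _ => ?_
    rw [eval_mul, eval_rootProduct]
    simp only [P, i.2, dif_pos, eval_finsetSum, Finset.sum_mul]
    refine Finset.sum_congr rfl fun e _ => ?_
    have hM : Ma a ⟨i, e⟩ c = x c ^ ((e : ℕ) + t i) * ∏ j ∈ A i, (x c - a j) := by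
      change MvPolynomial.eval a (M ⟨i, e⟩ c) = _
      simp [M]
    rw [hM]
    simp [pow_add]
    ring
  have hPdeg : ∀ w, ∀ i ∈ S, (P w i).degree < d i := by
    intro w i hi
    simp only [P, hi, dif_pos]
    exact degree_sum_fin_lt _
  have hPinj : ∀ w, (∀ i ∈ S, P w i = 0) → w = 0 := by
    rintro w hw
    funext ⟨⟨i, hi⟩, e⟩
    have := congrArg (fun q => q.coeff (e : ℕ)) (hw i hi)
    simpa [P, hi, finsetSum_coeff, coeff_X_pow, Fin.val_inj] using this
  have hPsurj : ∀ p : ι → K[X], (∀ i ∈ S, (p i).degree < d i) → ∃ w, ∀ i ∈ S, P w i = p i := by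
    intro p hp
    refine ⟨fun s => (p s.1).coeff s.2, fun i hi => ?_⟩
    simp only [P, hi, dif_pos]
    have h1 := Finset.sum_range (n := d i) fun e => C ((p i).coeff e) * X ^ e
    rw [← h1]
    ext c
    have hc := (degree_lt_iff_coeff_zero (p i) (d i)).1 (hp i hi) c
    simp only [finsetSum_coeff, coeff_C_mul, coeff_X_pow, mul_ite, mul_one, mul_zero,
      Finset.sum_ite_eq, Finset.mem_range]
    split_ifs with h2
    · rfl
    · exact (hc (not_lt.1 h2)).symm
  have hinj : Function.Injective (Matrix.toLinearMapRight' (Ma a₀)) := by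
    rw [injective_iff_map_eq_zero]
    intro w hw
    refine hPinj w (h (P w) (hPdeg w) ?_)
    refine eq_zero_of_degree_lt_of_eval_index_eq_zero (s := Finset.univ) (v := x)
      (fun c _ c' _ hc => hx hc) ?_ ?_
    · rw [Finset.card_univ, Fintype.card_fin]
      refine (degree_sum_le _ _).trans_lt ((Finset.sup_lt_iff (WithBot.bot_lt_coe k)).2 ?_)
      intro i hi
      refine lt_of_lt_of_le ((degree_mul_rootProduct_lt_iff _ _ _ _ _).2 (hPdeg w i hi)) ?_
      exact Nat.cast_le.2 (hk i hi)
    · intro c _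
      rw [← hvec]
      exact congrFun hw c
  -- A constant right inverse N of the matrix at a₀ makes M N square with determinant 1 at a₀. This
  -- avoids choosing a minor.
  obtain ⟨g, hg⟩ := LinearMap.exists_leftInverse_of_injective _ (LinearMap.ker_eq_bot.2 hinj)
  let N : Matrix (Fin k) T K := LinearMap.toMatrixRight' g
  have hN : Ma a₀ * N = 1 := by
    apply Matrix.toLinearMapRight'.injective
    rw [Matrix.toLinearMapRight'_mul, Matrix.toLinearMapRight'_one, ← hg]
    simp [N]
  let Q : Matrix T T (MvPolynomial σ K) := M * N.map (⇑MvPolynomial.C : K → MvPolynomial σ K)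
  let D : MvPolynomial σ K := Q.det
  have hD : ∀ a, MvPolynomial.eval a D = (Ma a * N).det := by
    intro a
    simp only [D]
    rw [RingHom.map_det, RingHom.mapMatrix_apply, Matrix.map_mul]
    congr 2
    ext i j
    simp
  refine ⟨D, ?_, ?_, ?_⟩
  · intro h0
    have := hD a₀
    rw [hN, h0] at this
    simp at this
  · have hM : ∀ s c, (M s c).totalDegree ≤ Fintype.card σ := by
      intro s c
      refine (MvPolynomial.totalDegree_mul _ _).trans ?_
      rw [MvPolynomial.totalDegree_C, zero_add]
      refine (MvPolynomial.totalDegree_finsetProd _ _).trans ?_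
      refine (Finset.sum_le_card_nsmul _ _ 1 fun j _ => ?_).trans ?_
      · refine (MvPolynomial.totalDegree_sub _ _).trans ?_
        simp
      · simpa using Finset.card_le_univ (A s.1)
    have hMN : ∀ s s', (Q s s').totalDegree ≤ Fintype.card σ := by
      intro s s'
      simp only [Q, Matrix.mul_apply]
      refine MvPolynomial.totalDegree_finsetSum_le fun c _ => ?_
      refine (MvPolynomial.totalDegree_mul _ _).trans ?_
      simpa using hM s c
    have hT : Fintype.card T = ∑ i ∈ S, d i := by
      rw [Fintype.card_sigma, ← Finset.sum_coe_sort S]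
      simp
    simp only [D, Matrix.det_apply]
    refine MvPolynomial.totalDegree_finsetSum_le fun π _ => ?_
    refine (MvPolynomial.totalDegree_smul_le _ _).trans ?_
    refine (MvPolynomial.totalDegree_finsetProd _ _).trans ?_
    refine (Finset.sum_le_card_nsmul _ _ _ fun s _ => hMN _ _).trans ?_
    rw [Finset.card_univ, hT, smul_eq_mul]
  · intro a ha p hp hsum
    obtain ⟨w, hw⟩ := hPsurj p hp
    have hw0 : Matrix.vecMul w (Ma a) = 0 := by
      funext c
      rw [hvec, Finset.sum_congr rfl fun i hi => by rw [hw i hi], hsum]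
      simp
    have : w = 0 := by
      rw [hD] at ha
      refine Matrix.eq_zero_of_vecMul_eq_zero ha ?_
      rw [← Matrix.vecMul_vecMul, hw0, Matrix.zero_vecMul]
    intro i hi
    rw [← hw i hi, this]
    simp [P]

end Openness

/-! ### The GM-MDS theorem, by induction on specializations and divisions. -/

section Existence

variable {K σ ι : Type*} [Field K]

/-- Over an infinite field the product of two nonzero certificates is nonzero at some point. -/
theorem IndepMultiples.exists_common [Infinite K] [Fintype σ] {S S' : Finset ι}
    {A A' : ι → Finset σ} {t t' d d' : ι → ℕ} {k : ℕ}
    (hk : ∀ i ∈ S, (A i).card + t i + d i ≤ k) (hk' : ∀ i ∈ S', (A' i).card + t' i + d' i ≤ k)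
    (h : ∃ a : σ → K, IndepMultiples S A t d a) (h' : ∃ a : σ → K, IndepMultiples S' A' t' d' a) :
    ∃ a : σ → K, IndepMultiples S A t d a ∧ IndepMultiples S' A' t' d' a := by
  obtain ⟨a₁, h₁⟩ := h
  obtain ⟨a₂, h₂⟩ := h'
  obtain ⟨D₁, hD₁, -, H₁⟩ := h₁.exists_certificate hk
  obtain ⟨D₂, hD₂, -, H₂⟩ := h₂.exists_certificate hk'
  by_contra! hne
  refine mul_ne_zero hD₁ hD₂ (MvPolynomial.funext fun a => ?_)
  rw [map_mul, map_zero]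
  by_contra hz
  exact hne a (H₁ a (left_ne_zero_of_mul hz)) (H₂ a (right_ne_zero_of_mul hz))

/-- The certificate is multiplied by the product of all indeterminates, which forces nonzero
coordinates. -/
theorem IndepMultiples.exists_ne_zero [Infinite K] [Fintype σ] {S : Finset ι}
    {A : ι → Finset σ} {t d : ι → ℕ} {k : ℕ}
    (hk : ∀ i ∈ S, (A i).card + t i + d i ≤ k)
    (h : ∃ a : σ → K, IndepMultiples S A t d a) :
    ∃ a : σ → K, (∀ j, a j ≠ 0) ∧ IndepMultiples S A t d a := by
  obtain ⟨a₁, h₁⟩ := h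
  obtain ⟨D, hD, -, H⟩ := h₁.exists_certificate hk
  by_contra! hne
  refine mul_ne_zero hD (Finset.prod_ne_zero_iff.2 fun j (_ : j ∈ Finset.univ) =>
    MvPolynomial.X_ne_zero (R := K) j) (MvPolynomial.funext fun a => ?_)
  rw [map_mul, map_zero, map_prod]
  by_contra hz
  refine hne a (fun j => ?_) (H a (left_ne_zero_of_mul hz))
  simpa using Finset.prod_ne_zero_iff.1 (right_ne_zero_of_mul hz) j (Finset.mem_univ j)

variable {k : ℕ} {S : Finset ι} {A : ι → Finset σ} {t d : ι → ℕ}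

/-- Dividing all members by the distinguished root. -/
theorem IndepMultiples.of_pred (ht : ∀ i ∈ S, 0 < t i) {a : σ → K}
    (h : IndepMultiples S A (fun i => t i - 1) d a) : IndepMultiples S A t d a := by
  intro p hp hsum
  refine h p hp (mul_left_cancel₀ X_ne_zero ?_)
  rw [mul_zero, ← hsum, Finset.mul_sum]
  refine Finset.sum_congr rfl fun i hi => ?_
  conv_rhs => rw [← Nat.sub_add_cancel (ht i hi), rootProduct_succ]
  ring

/-- Identifying the root `a j` with the distinguished root. -/
theorem IndepMultiples.of_merge [DecidableEq σ] {j : σ} {a : σ → K}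
    (h : IndepMultiples S (fun i => (A i).erase j) (fun i => t i + if j ∈ A i then 1 else 0) d a) :
    IndepMultiples S A t d (Function.update a j 0) := by
  intro p hp hsum
  refine h p hp ?_
  rw [← hsum]
  exact Finset.sum_congr rfl fun i _ => by rw [rootProduct_update_zero]

/-- If exactly one member is not divisible by `X`, then evaluation at `0` allows to divide by
`X`. -/
theorem IndepMultiples.of_pred_of_eval [DecidableEq ι] {i₀ : ι} (hi₀ : i₀ ∈ S) (ht₀ : t i₀ = 0)
    (ht : ∀ i ∈ S, i ≠ i₀ → 0 < t i) (hd : 0 < d i₀) {a : σ → K} (ha : ∀ j, a j ≠ 0)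
    (h : IndepMultiples S A (fun i => t i - 1) (Function.update d i₀ (d i₀ - 1)) a) :
    IndepMultiples S A t d a := by
  intro p hp hsum
  have hz : (p i₀).eval 0 = 0 := by
    have h0 := congrArg (eval 0) hsum
    rw [eval_finsetSum, Finset.sum_eq_single_of_mem i₀ hi₀ fun i hi hne => ?_, eval_mul,
      eval_rootProduct, ht₀, eval_zero] at h0
    · refine (mul_eq_zero.1 h0).resolve_right (mul_ne_zero (by simp) ?_)
      exact Finset.prod_ne_zero_iff.2 fun j _ => by simpa using ha j
    · rw [eval_mul, eval_rootProduct, zero_pow (ht i hi hne).ne']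
      simp
  obtain ⟨r, hr⟩ := X_dvd_iff.2 ((coeff_zero_eq_eval_zero _).trans hz)
  have hr' : ∀ i ∈ S, X * (Function.update p i₀ r i * rootProduct a (A i) (t i - 1)) =
      p i * rootProduct a (A i) (t i) := by
    intro i hi
    rcases eq_or_ne i i₀ with rfl | hne
    · rw [Function.update_self, ht₀, hr]
      ring
    · rw [Function.update_of_ne hne]
      conv_rhs => rw [← Nat.sub_add_cancel (ht i hi hne), rootProduct_succ]
      ring
  have key := h (Function.update p i₀ r) (fun i hi => by
      rcases eq_or_ne i i₀ with rfl | hne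
      · rw [Function.update_self, Function.update_self]
        have := hp i hi
        rw [hr] at this
        rcases eq_or_ne r 0 with rfl | hr0
        · simp
        · rw [degree_mul, degree_X, degree_eq_natDegree hr0] at this
          rw [degree_eq_natDegree hr0]
          norm_cast at this ⊢
          omega
      · rw [Function.update_of_ne hne, Function.update_of_ne hne]
        exact hp i hi) (mul_left_cancel₀ X_ne_zero (by
      rw [mul_zero, ← hsum, Finset.mul_sum]
      exact Finset.sum_congr rfl hr'))
  intro i hi
  rcases eq_or_ne i i₀ with rfl | hne
  · have := key i hi
    rw [Function.update_self] at this
    rw [hr, this, mul_zero]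
  · simpa [Function.update_of_ne hne] using key i hi

variable [Fintype σ] [DecidableEq σ]

theorem IsAdmissible.mono {S' : Finset ι} (h : IsAdmissible k S A t d) (hS : S' ⊆ S) :
    IsAdmissible k S' A t d :=
  ⟨fun i hi => h.size i (hS hi), fun I hI => h.bound I (hI.trans hS)⟩

theorem mem_finset_inf {I : Finset ι} {x : σ} : x ∈ I.inf A ↔ ∀ i ∈ I, x ∈ A i := by
  classical
  induction I using Finset.induction_on with
  | empty => simp
  | insert a s _ ih => simp [ih]

/-- If a subfamily `I` is tight, it may be replaced by its greatest common divisor. -/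
theorem IsAdmissible.contract [DecidableEq ι] (h : IsAdmissible k S A t d) {I : Finset ι}
    (hI : I ⊆ S) {i₀ : ι} (hi₀ : i₀ ∈ I) (hmin : ∀ i ∈ I, t i₀ ≤ t i)
    (htight : ∑ l ∈ I, d l + (I.inf A).card + t i₀ = k) :
    IsAdmissible k (insert i₀ (S \ I)) (Function.update A i₀ (I.inf A)) t
      (Function.update d i₀ (∑ l ∈ I, d l)) := by
  have hne : ∀ i ∈ S \ I, i ≠ i₀ := fun i hi h' => (Finset.mem_sdiff.1 hi).2 (h' ▸ hi₀)
  refine ⟨fun i hi => ?_, fun I' hI' hI'ne => ?_⟩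
  · rcases Finset.mem_insert.1 hi with rfl | hi
    · simp only [Function.update_self]; omega
    · rw [Function.update_of_ne (hne i hi), Function.update_of_ne (hne i hi)]
      exact h.size i (Finset.mem_sdiff.1 hi).1
  · by_cases h0 : i₀ ∈ I'
    · have hJS : I'.erase i₀ ⊆ S \ I := fun i hi =>
        (Finset.mem_insert.1 (hI' (Finset.mem_of_mem_erase hi))).resolve_left
          (Finset.ne_of_mem_erase hi)
      have hdisj : Disjoint (I'.erase i₀) I :=
        Finset.disjoint_left.2 fun i hi => (Finset.mem_sdiff.1 (hJS hi)).2
      obtain ⟨i, hi, hb⟩ := h.bound (I'.erase i₀ ∪ I)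
        (Finset.union_subset (hJS.trans Finset.sdiff_subset) hI) ⟨i₀, Finset.mem_union_right _ hi₀⟩
      have hsum : ∑ l ∈ I', Function.update d i₀ (∑ l ∈ I, d l) l =
          ∑ l ∈ I'.erase i₀ ∪ I, d l := by
        rw [Finset.sum_union hdisj, ← Finset.sum_erase_add _ _ h0, Function.update_self]
        congr 1
        exact Finset.sum_congr rfl fun l hl => Function.update_of_ne (Finset.ne_of_mem_erase hl) _ _
      have hsub : I'.inf (Function.update A i₀ (I.inf A)) ⊆ (I'.erase i₀ ∪ I).inf A := by
        intro x hx
        rw [mem_finset_inf] at hx ⊢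
        intro l hl
        rcases Finset.mem_union.1 hl with hl | hl
        · simpa [Function.update_of_ne (Finset.ne_of_mem_erase hl)] using
            hx l (Finset.mem_of_mem_erase hl)
        · have := hx i₀ h0
          rw [Function.update_self, mem_finset_inf] at this
          exact this l hl
      have hcard := Finset.card_le_card hsub
      rcases Finset.mem_union.1 hi with hi | hi
      · exact ⟨i, Finset.mem_of_mem_erase hi, by omega⟩
      -- The contracted member keeps the least multiplicity of I, so it can replace any witness from
      -- I.
      · exact ⟨i₀, h0, by have := hmin i hi; omega⟩
    · have hI'S : I' ⊆ S \ I := fun i hi =>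
        (Finset.mem_insert.1 (hI' hi)).resolve_left fun h' => h0 (h' ▸ hi)
      obtain ⟨i, hi, hb⟩ := h.bound I' (hI'S.trans Finset.sdiff_subset) hI'ne
      refine ⟨i, hi, ?_⟩
      rw [Finset.inf_congr rfl fun l hl => Function.update_of_ne (hne l (hI'S hl)) (I.inf A) A,
        Finset.sum_congr rfl fun l hl =>
          Function.update_of_ne (hne l (hI'S hl)) (∑ l ∈ I, d l) d]
      exact hb

/-- The part of a relation indexed by I is q times the common divisor, and tightness makes the
degree bound on q exactly the one allowed to the contracted member. Independence of the contracted
family kills q, and independence of I then kills the individual coefficients. -/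
theorem IndepMultiples.of_contract [DecidableEq ι] (hsize : ∀ i ∈ S, (A i).card + t i + d i = k)
    {I : Finset ι} (hI : I ⊆ S) {i₀ : ι} (hi₀ : i₀ ∈ I) (hmin : ∀ i ∈ I, t i₀ ≤ t i)
    (htight : ∑ l ∈ I, d l + (I.inf A).card + t i₀ = k) {a : σ → K}
    (h₁ : IndepMultiples I A t d a)
    (h₂ : IndepMultiples (insert i₀ (S \ I)) (Function.update A i₀ (I.inf A)) t
      (Function.update d i₀ (∑ l ∈ I, d l)) a) :
    IndepMultiples S A t d a := by
  intro p hp hsum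
  have hne : ∀ i ∈ S \ I, i ≠ i₀ := fun i hi h' => (Finset.mem_sdiff.1 hi).2 (h' ▸ hi₀)
  have hnot : i₀ ∉ S \ I := fun h => hne _ h rfl
  let q : K[X] := ∑ i ∈ I, p i * rootProduct a (A i \ I.inf A) (t i - t i₀)
  have hq : q * rootProduct a (I.inf A) (t i₀) = ∑ i ∈ I, p i * rootProduct a (A i) (t i) := by
    rw [Finset.sum_mul]
    refine Finset.sum_congr rfl fun i hi => ?_
    have hle : I.inf A ⊆ A i := Finset.inf_le (f := A) hi
    rw [mul_assoc, ← rootProduct_eq_mul_of_subset a hle (hmin i hi)]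
  have hqdeg : q.degree < (∑ l ∈ I, d l : ℕ) := by
    rw [← degree_mul_rootProduct_lt_iff a (I.inf A) (t i₀), hq]
    refine (degree_sum_le _ _).trans_lt ((Finset.sup_lt_iff (WithBot.bot_lt_coe _)).2 ?_)
    intro i hi
    have h1 := (degree_mul_rootProduct_lt_iff a (A i) (t i) (d i) (p i)).2 (hp i (hI hi))
    rw [hsize i (hI hi)] at h1
    convert h1 using 2
    omega
  have key := h₂ (Function.update p i₀ q) (fun i hi => by
      rcases Finset.mem_insert.1 hi with rfl | hi
      · simpa using hqdeg
      · rw [Function.update_of_ne (hne i hi), Function.update_of_ne (hne i hi)]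
        exact hp i (Finset.mem_sdiff.1 hi).1) (by
      rw [Finset.sum_insert hnot, Function.update_self, Function.update_self, hq, ← hsum,
        ← Finset.sum_sdiff hI, add_comm]
      congr 1
      refine Finset.sum_congr rfl fun i hi => ?_
      rw [Function.update_of_ne (hne i hi), Function.update_of_ne (hne i hi)])
  have hq0 : q = 0 := by simpa using key i₀ (Finset.mem_insert_self _ _)
  have hI0 := h₁ p (fun i hi => hp i (hI hi)) (by rw [← hq, hq0, zero_mul])
  intro i hi
  by_cases hiI : i ∈ I
  · exact hI0 i hiI
  · have hi' := Finset.mem_sdiff.2 ⟨hi, hiI⟩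
    simpa [Function.update_of_ne (hne i hi')] using key i (Finset.mem_insert_of_mem hi')

theorem IsAdmissible.pred (hA : IsAdmissible (k + 1) S A t d) (ht : ∀ i ∈ S, 0 < t i) :
    IsAdmissible k S A (fun i => t i - 1) d := by
  refine ⟨fun i hi => ?_, fun I hI hne => ?_⟩
  · have := hA.size i hi
    have := ht i hi
    omega
  · obtain ⟨i, hi, hb⟩ := hA.bound I hI hne
    have := ht i (hI hi)
    exact ⟨i, hi, by omega⟩

/-- Merging raises a multiplicity by at most one, which the strict inequality absorbs for proper
subfamilies with at least two members. For the whole family, i₀ keeps multiplicity 0; for singletons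
the bound is the size identity. -/
theorem IsAdmissible.merge (hA : IsAdmissible k S A t d)
    (hstrict : ∀ I ⊆ S, 1 < I.card → I ≠ S →
      ∃ i ∈ I, ∑ l ∈ I, d l + (I.inf A).card + t i < k)
    {i₀ : ι} (hi₀ : i₀ ∈ S) (ht : t i₀ = 0) {j : σ} (hj : j ∉ A i₀) :
    IsAdmissible k S (fun i => (A i).erase j) (fun i => t i + if j ∈ A i then 1 else 0) d := by
  have hsize : ∀ i ∈ S,
      ((A i).erase j).card + (t i + if j ∈ A i then 1 else 0) + d i = k := by
    intro i hi
    have := hA.size i hi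
    split_ifs with hji
    · have := Finset.card_erase_add_one hji
      omega
    · rw [Finset.erase_eq_of_notMem hji]
      omega
  refine ⟨hsize, fun I hI hne => ?_⟩
  have hcard : (I.inf fun i => (A i).erase j).card ≤ (I.inf A).card :=
    Finset.card_le_card (Finset.inf_mono_fun fun i _ => Finset.erase_subset j (A i))
  rcases eq_or_ne I S with rfl | hIS
  · obtain ⟨i, hi, hb⟩ := hA.bound I hI hne
    refine ⟨i₀, hi₀, ?_⟩
    rw [if_neg hj, ht]
    omega
  · by_cases h1 : 1 < I.card
    · obtain ⟨i, hi, hb⟩ := hstrict I hI h1 hIS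
      refine ⟨i, hi, ?_⟩
      split_ifs <;> omega
    · obtain ⟨i, rfl⟩ := Finset.card_eq_one.1 (le_antisymm (not_lt.1 h1) hne.card_pos)
      refine ⟨i, Finset.mem_singleton_self i, ?_⟩
      have := hsize i (hI (Finset.mem_singleton_self i))
      rw [Finset.sum_singleton, Finset.inf_singleton]
      omega

/-- When k drops by one, subfamilies containing i₀ lose one dimension from its coefficient space,
and the others lose one from each multiplicity. -/
theorem IsAdmissible.pred_of_eval [DecidableEq ι] (hA : IsAdmissible (k + 1) S A t d)
    {i₀ : ι} (hi₀ : i₀ ∈ S) (ht₀ : t i₀ = 0)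
    (ht : ∀ i ∈ S, i ≠ i₀ → 0 < t i) (hd : 0 < d i₀) :
    IsAdmissible k S A (fun i => t i - 1) (Function.update d i₀ (d i₀ - 1)) := by
  refine ⟨fun i hi => ?_, fun I hI hne => ?_⟩
  · have := hA.size i hi
    rcases eq_or_ne i i₀ with rfl | hne
    · rw [Function.update_self]
      omega
    · have := ht i hi hne
      rw [Function.update_of_ne hne]
      omega
  · obtain ⟨i, hi, hb⟩ := hA.bound I hI hne
    by_cases h0 : i₀ ∈ I
    · refine ⟨i₀, h0, ?_⟩
      rw [← Finset.sum_erase_add _ _ h0, Function.update_self,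
        Finset.sum_congr rfl fun l hl => Function.update_of_ne (Finset.ne_of_mem_erase hl) _ _]
      rw [← Finset.sum_erase_add _ _ h0] at hb
      omega
    · have hi' : i ≠ i₀ := fun h => h0 (h ▸ hi)
      refine ⟨i, hi, ?_⟩
      rw [Finset.sum_congr rfl fun l hl =>
        Function.update_of_ne (fun h => h0 (h ▸ hl) : l ≠ i₀) _ _]
      have := ht i (hI hi) hi'
      omega

/-- The GM-MDS theorem: over an infinite field, an admissible family is linearly independent for
some choice of the roots. -/
theorem IsAdmissible.exists_indepMultiples [Infinite K] {U : Finset σ}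
    (hA : IsAdmissible k S A t d) (hU : ∀ i ∈ S, A i ⊆ U) :
    ∃ a : σ → K, IndepMultiples S A t d a := by
  classical
  -- U contains the roots not yet merged into 0. Each reduction lowers the number of members, k, or
  -- the size of U, without raising the other two.
  induction hN : S.card + k + U.card using Nat.strong_induction_on
    generalizing k S A t d U with
  | _ N ih =>
  subst hN
  by_cases hd : ∃ i ∈ S, d i = 0
  · obtain ⟨i, hi, hdi⟩ := hd
    obtain ⟨a, ha⟩ := ih _ (by have := Finset.card_erase_lt_of_mem hi; omega)
      (hA.mono (Finset.erase_subset i S)) (fun l hl => hU l (Finset.mem_of_mem_erase hl)) rfl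
    refine ⟨a, fun p hp hsum => ?_⟩
    have hpi : p i = 0 := by
      have := hp i hi
      rw [hdi] at this
      by_contra h0
      rw [degree_eq_natDegree h0] at this
      norm_cast at this
    rw [← Finset.sum_erase_add _ _ hi, hpi, zero_mul, add_zero] at hsum
    intro l hl
    rcases eq_or_ne l i with rfl | hne
    · exact hpi
    · exact ha p (fun l hl => hp l (Finset.mem_of_mem_erase hl)) hsum l (Finset.mem_erase.2 ⟨hne, hl⟩)
  push Not at hd
  rcases S.eq_empty_or_nonempty with rfl | hSne
  · exact ⟨0, fun p _ _ i hi => absurd hi (Finset.notMem_empty i)⟩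
  have hkpos : 0 < k := by
    obtain ⟨i, hi⟩ := hSne
    have := hA.size i hi
    have := hd i hi
    omega
  obtain ⟨k, rfl⟩ := Nat.exists_eq_succ_of_ne_zero hkpos.ne'
  by_cases htight : ∃ I ⊆ S, 1 < I.card ∧ I ≠ S ∧
      ∀ i ∈ I, k + 1 ≤ ∑ l ∈ I, d l + (I.inf A).card + t i
  · obtain ⟨I, hI, hI1, hIS, hIt⟩ := htight
    have hIne : I.Nonempty := Finset.card_pos.1 (by omega)
    obtain ⟨i₀, hi₀, hmin⟩ := I.exists_min_image t hIne
    have hteq : ∑ l ∈ I, d l + (I.inf A).card + t i₀ = k + 1 := by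
      obtain ⟨i, hi, hb⟩ := hA.bound I hI hIne
      have := hIt i₀ hi₀
      have := hmin i hi
      omega
    have hA₁ := hA.mono hI
    have hA₂ := hA.contract hI hi₀ hmin hteq
    have hlt := Finset.card_lt_card (hI.ssubset_of_ne hIS)
    have hcard : (insert i₀ (S \ I)).card < S.card := by
      have h1 := Finset.card_insert_le i₀ (S \ I)
      have h2 := Finset.card_sdiff_add_card_eq_card hI
      omega
    have h₁ := ih _ (by omega) hA₁ (fun l hl => hU l (hI hl)) rfl
    have h₂ := ih _ (by omega) hA₂ (U := U) (fun l hl => by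
      rcases Finset.mem_insert.1 hl with rfl | hl
      · rw [Function.update_self]
        exact (Finset.inf_le (f := A) hi₀).trans (hU _ (hI hi₀))
      · have hl' := Finset.mem_sdiff.1 hl
        rw [Function.update_of_ne fun h : l = i₀ => hl'.2 (h ▸ hi₀)]
        exact hU l hl'.1) rfl
    obtain ⟨a, ha₁, ha₂⟩ := IndepMultiples.exists_common (fun i hi => (hA₁.size i hi).le)
      (fun i hi => (hA₂.size i hi).le) h₁ h₂
    exact ⟨a, ha₁.of_contract hA.size hI hi₀ hmin hteq ha₂⟩
  push Not at htight
  by_cases ht : ∀ i ∈ S, 0 < t i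
  · obtain ⟨a, ha⟩ := ih _ (by omega) (hA.pred ht) hU rfl
    exact ⟨a, ha.of_pred ht⟩
  push Not at ht
  obtain ⟨i₀, hi₀, ht₀⟩ := ht
  have ht₀ : t i₀ = 0 := by omega
  by_cases hj : ∃ j ∈ U, j ∉ A i₀
  · obtain ⟨j, hjU, hj⟩ := hj
    obtain ⟨a, ha⟩ := ih _ (by have := Finset.card_erase_lt_of_mem hjU; omega)
      (hA.merge htight hi₀ ht₀ hj) (U := U.erase j)
      (fun i hi => Finset.erase_subset_erase j (hU i hi)) rfl
    exact ⟨_, ha.of_merge⟩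
  push Not at hj
  -- Now A i₀ contains every A i. A second member of multiplicity 0 would be a multiple-free
  -- companion: the bound for the pair, compared with its size identity, would force d i₀ = 0.
  have hpos : ∀ i ∈ S, i ≠ i₀ → 0 < t i := by
    intro i hi hne
    by_contra hti
    obtain ⟨l, hl, hb⟩ := hA.bound {i₀, i} (by
      intro x hx
      rcases Finset.mem_insert.1 hx with rfl | hx
      · exact hi₀
      · rwa [Finset.mem_singleton.1 hx]) ⟨i₀, Finset.mem_insert_self _ _⟩
    rw [Finset.sum_pair hne.symm, Finset.inf_insert, Finset.inf_singleton,
      inf_eq_right.2 ((hU i hi).trans hj : A i ≤ A i₀)] at hb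
    have := hA.size i hi
    have := hd i₀ hi₀
    omega
  have hd₀ := Nat.pos_of_ne_zero (hd i₀ hi₀)
  have hA' := hA.pred_of_eval hi₀ ht₀ hpos hd₀
  obtain ⟨a, ha, hind⟩ := IndepMultiples.exists_ne_zero (fun i hi => (hA'.size i hi).le)
    (ih _ (by omega) hA' hU rfl)
  exact ⟨a, hind.of_pred_of_eval hi₀ ht₀ hpos hd₀ ha⟩

end Existence

/-! ### From independent dual checks to equality of message polynomials. -/

section Duality

theorem finrank_polynomial_degreeLT (F : Type*) [Field F] (k : ℕ) :
    Module.finrank F (degreeLT F k) = k := by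
  rw [(degreeLTEquiv F k).finrank_eq, Module.finrank_fin_fun]

variable {F ι : Type*} [Field F]

/-- An independent family of maximal total dimension spans all multiples of its greatest common
divisor. -/
theorem IndepMultiples.exists_sum_eq {σ : Type*} [Fintype σ] [DecidableEq σ] {S : Finset ι}
    {A : ι → Finset σ} {t d : ι → ℕ} {a : σ → F} {m : ℕ} (h : IndepMultiples S A t d a)
    (hsize : ∀ i ∈ S, (A i).card + t i + d i = m) (hsum : ∑ i ∈ S, d i + (S.inf A).card = m)
    {q : F[X]} (hq : q.degree < (∑ i ∈ S, d i : ℕ)) :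
    ∃ p : ι → F[X], (∀ i ∈ S, (p i).degree < d i) ∧
      ∑ i ∈ S, p i * rootProduct a (A i) (t i) = q * rootProduct a (S.inf A) 0 := by
  classical
  let g : ι → F[X] := fun i => rootProduct a (A i \ S.inf A) (t i - 0)
  have hg : ∀ i ∈ S, g i * rootProduct a (S.inf A) 0 = rootProduct a (A i) (t i) := fun i hi =>
    (rootProduct_eq_mul_of_subset a (Finset.inf_le (f := A) hi) (Nat.zero_le _)).symm
  let Φ₀ : ((i : S) → degreeLT F (d i)) →ₗ[F] F[X] :=
    ∑ i : S, (LinearMap.mulRight F (g i)) ∘ₗ (degreeLT F (d i)).subtype ∘ₗ LinearMap.proj i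
  have hΦ₀ : ∀ p, Φ₀ p = ∑ i : S, (p i : F[X]) * g i := fun p => by simp [Φ₀]
  have hmul : ∀ p, Φ₀ p * rootProduct a (S.inf A) 0 =
      ∑ i : S, (p i : F[X]) * rootProduct a (A i) (t i) := by
    intro p
    rw [hΦ₀, Finset.sum_mul]
    exact Finset.sum_congr rfl fun i _ => by rw [mul_assoc, hg i i.2]
  have hdeg : ∀ p, Φ₀ p ∈ degreeLT F (∑ i ∈ S, d i) := by
    intro p
    rw [mem_degreeLT, ← degree_mul_rootProduct_lt_iff a (S.inf A) 0, hmul]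
    refine (degree_sum_le _ _).trans_lt ((Finset.sup_lt_iff (WithBot.bot_lt_coe _)).2 ?_)
    intro i _
    have h1 := (degree_mul_rootProduct_lt_iff a (A i) (t i) (d i) (p i)).2
      (mem_degreeLT.1 (p i).2)
    rw [hsize i i.2] at h1
    convert h1 using 2
    omega
  let Φ : ((i : S) → degreeLT F (d i)) →ₗ[F] degreeLT F (∑ i ∈ S, d i) :=
    Φ₀.codRestrict _ hdeg
  let ext : ((i : S) → degreeLT F (d i)) → ι → F[X] := fun p i =>
    if hi : i ∈ S then (p ⟨i, hi⟩ : F[X]) else 0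
  have hext : ∀ p (i : S), ext p i = p i := fun p i => by simp [ext]
  have hextdeg : ∀ p, ∀ i ∈ S, (ext p i).degree < d i := fun p i hi => by
    rw [hext p ⟨i, hi⟩]
    exact mem_degreeLT.1 (p ⟨i, hi⟩).2
  have hextsum : ∀ p, ∑ i ∈ S, ext p i * rootProduct a (A i) (t i) =
      Φ₀ p * rootProduct a (S.inf A) 0 := by
    intro p
    rw [hmul, ← Finset.sum_coe_sort S]
    exact Finset.sum_congr rfl fun i _ => by rw [hext]
  have hinj : Function.Injective Φ := by
    rw [injective_iff_map_eq_zero]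
    intro p hp
    have h0 : Φ₀ p = 0 := congrArg Subtype.val hp
    have := h (ext p) (hextdeg p) (by rw [hextsum, h0, zero_mul])
    funext i
    refine Subtype.ext ?_
    rw [← hext]
    exact this i i.2
  have hfin : ∀ k : ℕ, FiniteDimensional F (degreeLT F k) := fun k =>
    (degreeLTEquiv F k).symm.finiteDimensional
  have hrank : Module.finrank F ((i : S) → degreeLT F (d i)) =
      Module.finrank F (degreeLT F (∑ i ∈ S, d i)) := by
    rw [Module.finrank_pi_fintype, finrank_polynomial_degreeLT, ← Finset.sum_coe_sort S]
    exact Finset.sum_congr rfl fun i _ => finrank_polynomial_degreeLT F (d i)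
  -- Source and target both have dimension ∑ d i, so injectivity gives surjectivity.
  obtain ⟨p, hp⟩ := (LinearMap.injective_iff_surjective_of_finrank_eq_finrank hrank).1 hinj
    ⟨q, mem_degreeLT.2 hq⟩
  have hp' : Φ₀ p = q := congrArg Subtype.val hp
  exact ⟨ext p, hextdeg p, by rw [hextsum, hp']⟩

variable {n m k : ℕ}

/-- The dual of a Reed-Solomon code is a generalized Reed-Solomon code. -/
theorem sum_eval_mul_eval_div_eq_zero {α : Fin n → F} (hα : Function.Injective α)
    (hmk : m + k = n) {P f : F[X]} (hP : P.degree < m) (hf : f.degree < k) :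
    ∑ x, P.eval (α x) * f.eval (α x) / ∏ z ∈ Finset.univ.erase x, (α x - α z) = 0 := by
  rcases eq_or_ne P 0 with rfl | hP0
  · simp
  rcases eq_or_ne f 0 with rfl | hf0
  · simp
  have hdeg : (P * f).natDegree < n - 1 := by
    rw [degree_eq_natDegree hP0] at hP
    rw [degree_eq_natDegree hf0] at hf
    rw [natDegree_mul hP0 hf0]
    norm_cast at hP hf
    omega
  -- The sum is the coefficient of X^(n-1) in the Lagrange interpolation of P f, whose degree is at
  -- most n - 2.
  have h := Lagrange.coeff_eq_sum (s := Finset.univ) (v := α) hα.injOn (P := P * f) (by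
    rw [Finset.card_univ, Fintype.card_fin, degree_eq_natDegree (mul_ne_zero hP0 hf0)]
    norm_cast
    omega)
  rw [Finset.card_univ, Fintype.card_fin, coeff_eq_zero_of_natDegree_lt hdeg] at h
  simpa using h.symm

/-- If the polynomials vanishing on the error sets `A i` span as much as they can, then the
message polynomials `f i` with these error sets coincide. -/
theorem IndepMultiples.eq_of_agree {α : Fin n → F} (hα : Function.Injective α)
    (hmk : m + k = n) {S : Finset ι} {A : ι → Finset (Fin n)} {t d : ι → ℕ}
    (h : IndepMultiples S A t d α) (hsize : ∀ i ∈ S, (A i).card + t i + d i = m)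
    (hsum : ∑ i ∈ S, d i + (S.inf A).card = m) {y : Fin n → F} {f : ι → F[X]}
    (hf : ∀ i ∈ S, (f i).degree < k) (hy : ∀ i ∈ S, ∀ x, x ∉ A i → (f i).eval (α x) = y x)
    {i i' : ι} (hi : i ∈ S) (hi' : i' ∈ S) : f i = f i' := by
  set w : Fin n → F := fun x => ∏ z ∈ Finset.univ.erase x, (α x - α z) with hw
  have hw0 : ∀ x, w x ≠ 0 := fun x => Finset.prod_ne_zero_iff.2 fun z hz =>
    sub_ne_zero.2 fun hxz => Finset.ne_of_mem_erase hz (hα hxz).symm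
  have hroot : ∀ (B : Finset (Fin n)) s, ∀ x ∈ B, (rootProduct α B s).eval (α x) = 0 := by
    intro B s x hx
    rw [eval_rootProduct, Finset.prod_eq_zero hx (sub_self _), mul_zero]
  have hS : ∀ l ∈ S, ∀ p : F[X], p.degree < d l →
      ∑ x, (p * rootProduct α (A l) (t l)).eval (α x) * y x / w x = 0 := by
    intro l hl p hp
    rw [← sum_eval_mul_eval_div_eq_zero hα hmk (P := p * rootProduct α (A l) (t l)) (by
      have h1 := (degree_mul_rootProduct_lt_iff α (A l) (t l) (d l) p).2 hp
      rwa [hsize l hl] at h1) (hf l hl)]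
    refine Finset.sum_congr rfl fun x _ => ?_
    by_cases hx : x ∈ A l
    · rw [eval_mul, hroot _ _ x hx]
      simp
    · rw [hy l hl x hx]
  have hagree : ∀ l ∈ S, ∀ x, x ∉ S.inf A → (f l).eval (α x) = y x := by
    intro l hl x₀ hx₀
    by_cases hxl : x₀ ∈ A l
    swap
    · exact hy l hl x₀ hxl
    have hle : S.inf A ⊆ A l := Finset.inf_le (f := A) hl
    have hcard := Finset.card_sdiff_add_card_eq_card hle
    have hmem : x₀ ∈ A l \ S.inf A := Finset.mem_sdiff.2 ⟨hxl, hx₀⟩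
    have hcard' := Finset.card_erase_add_one hmem
    have hl' := hsize l hl
    have hqdeg : (rootProduct α ((A l \ S.inf A).erase x₀) 0).degree < (∑ i ∈ S, d i : ℕ) := by
      rw [degree_rootProduct]
      norm_cast
      omega
    obtain ⟨p, hp, hpq⟩ := h.exists_sum_eq hsize hsum hqdeg
    -- Q vanishes on A l except at x₀, and f l agrees with y off A l. As Q is a check for both y and
    -- f l, only the term at x₀ of their difference survives, so f l and y agree there too.
    set Q := rootProduct α ((A l \ S.inf A).erase x₀) 0 * rootProduct α (S.inf A) 0 with hQ
    have h1 : ∑ x, Q.eval (α x) * y x / w x = 0 := by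
      rw [← hpq]
      simp only [eval_finsetSum, Finset.sum_mul, Finset.sum_div]
      rw [Finset.sum_comm]
      exact Finset.sum_eq_zero fun i hi => hS i hi (p i) (hp i hi)
    have h2 : ∑ x, Q.eval (α x) * (f l).eval (α x) / w x = 0 := by
      refine sum_eval_mul_eval_div_eq_zero hα hmk ?_ (hf l hl)
      rw [hQ, degree_mul, degree_rootProduct, degree_rootProduct]
      norm_cast
      omega
    have h3 : ∑ x, Q.eval (α x) * ((f l).eval (α x) - y x) / w x = 0 := by
      rw [← sub_zero (0 : F)]
      nth_rw 1 [← h2]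
      rw [← h1, ← Finset.sum_sub_distrib]
      exact Finset.sum_congr rfl fun x _ => by ring
    rw [Finset.sum_eq_single x₀ (fun x _ hx => ?_) (by simp)] at h3
    · have hQ0 : Q.eval (α x₀) ≠ 0 := by
        rw [hQ, eval_mul, eval_rootProduct, eval_rootProduct, pow_zero, one_mul, one_mul]
        refine mul_ne_zero (Finset.prod_ne_zero_iff.2 fun z hz => ?_)
          (Finset.prod_ne_zero_iff.2 fun z hz => ?_)
        · exact sub_ne_zero.2 fun hxz => Finset.ne_of_mem_erase hz (hα hxz).symm
        · exact sub_ne_zero.2 fun hxz => hx₀ (hα hxz ▸ hz)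
      have := (div_eq_zero_iff.1 h3).resolve_right (hw0 x₀)
      exact sub_eq_zero.1 ((mul_eq_zero.1 this).resolve_left hQ0)
    · by_cases hxA : x ∈ A l
      · have : Q.eval (α x) = 0 := by
          rw [hQ, eval_mul]
          by_cases hx0 : x ∈ S.inf A
          · rw [hroot _ _ x hx0, mul_zero]
          · rw [hroot _ _ x (Finset.mem_erase.2 ⟨hx, Finset.mem_sdiff.2 ⟨hxA, hx0⟩⟩), zero_mul]
        rw [this, zero_mul, zero_div]
      · rw [hy l hl x hxA, sub_self, mul_zero, zero_div]
  -- The intersection has at most m = n - k elements, which leaves k positions for interpolation.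
  have hcompl : k ≤ ((S.inf A)ᶜ).card := by
    rw [Finset.card_compl, Fintype.card_fin]
    omega
  have hk : (k : WithBot ℕ) ≤ ((S.inf A)ᶜ).card := Nat.cast_le.2 hcompl
  refine eq_of_degrees_lt_of_eval_index_eq (s := (S.inf A)ᶜ) (v := α) hα.injOn
    ((hf i hi).trans_le hk) ((hf i' hi').trans_le hk) fun x hx => ?_
  rw [Finset.mem_compl] at hx
  rw [hagree i hi x hx, hagree i' hi' x hx]

/-- Independence descends along field extensions. -/
theorem IndepMultiples.of_map {K σ : Type*} [Field K] (φ : F →+* K) {S : Finset ι}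
    {A : ι → Finset σ} {t d : ι → ℕ} {a : σ → F}
    (h : IndepMultiples S A t d fun j => φ (a j)) : IndepMultiples S A t d a := by
  intro p hp hsum i hi
  have := h (fun i => (p i).map φ) (fun i hi => by
      rw [degree_map]
      exact hp i hi) (by
      have h0 := congrArg (Polynomial.map φ) hsum
      simpa only [Polynomial.map_sum, Polynomial.map_mul, Polynomial.map_zero, map_rootProduct]
        using h0) i hi
  exact (Polynomial.map_eq_zero φ).1 this

end Duality

/-! ### Choosing an admissible subfamily of the error sets. -/

section Selection

variable {σ ι : Type*} [Fintype σ] [DecidableEq σ]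

/-- Among sets that are small on average, some subfamily can be completed to an admissible
family of full total dimension. -/
theorem exists_isAdmissible {m : ℕ} {S : Finset ι} {A : ι → Finset σ} (hS : 1 < S.card)
    (hA : ∀ i ∈ S, (A i).card ≤ m) (hsum : m ≤ ∑ i ∈ S, (m - (A i).card)) :
    ∃ J ⊆ S, 1 < J.card ∧ ∃ t d : ι → ℕ, IsAdmissible m J A t d ∧
      ∑ i ∈ J, d i + (J.inf A).card = m := by
  classical
  -- A smallest subfamily reaching dimension m is taken, so that its proper subfamilies do not
  -- exceed m.
  let 𝒥 := S.powerset.filter fun J =>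
    1 < J.card ∧ m ≤ ∑ i ∈ J, (m - (A i).card) + (J.inf A).card
  have hne : 𝒥.Nonempty := ⟨S, by simp only [𝒥, Finset.mem_filter, Finset.mem_powerset]; exact
    ⟨Finset.Subset.refl S, hS, by omega⟩⟩
  obtain ⟨J, hJ, hmin⟩ := 𝒥.exists_min_image Finset.card hne
  simp only [𝒥, Finset.mem_filter, Finset.mem_powerset] at hJ hmin
  obtain ⟨hJS, hJ1, hJm⟩ := hJ
  have hle : ∀ I ⊆ J, I ≠ J → I.Nonempty → ∑ i ∈ I, (m - (A i).card) + (I.inf A).card ≤ m := by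
    intro I hI hIJ hIne
    by_cases h1 : 1 < I.card
    · by_contra! hlt
      have := hmin I ⟨hI.trans hJS, h1, hlt.le⟩
      have := Finset.card_lt_card (hI.ssubset_of_ne hIJ)
      omega
    · obtain ⟨i, rfl⟩ := Finset.card_eq_one.1 (le_antisymm (not_lt.1 h1) hIne.card_pos)
      have := hA i (hJS (hI (Finset.mem_singleton_self i)))
      rw [Finset.sum_singleton, Finset.inf_singleton]
      omega
  have hother : ∀ I : Finset ι, 1 < I.card → ∀ j, ∃ i ∈ I, i ≠ j := fun I hI j =>
    Finset.exists_mem_ne hI j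
  obtain ⟨j, hj⟩ := Finset.card_pos.1 (zero_lt_one.trans hJ1)
  obtain ⟨e, he⟩ := Nat.exists_eq_add_of_le hJm
  -- Without j the count is at most m, so the excess e comes from j alone. It is removed by giving j
  -- the multiplicity e at the root 0; every subfamily of two or more still has a member of
  -- multiplicity 0.
  have hej : e ≤ m - (A j).card := by
    have h1 := hle (J.erase j) (Finset.erase_subset j J) (Finset.erase_ne_self.2 hj) (by
      obtain ⟨i, hi, hij⟩ := hother J hJ1 j
      exact ⟨i, Finset.mem_erase.2 ⟨hij, hi⟩⟩)
    have h2 : (J.inf A).card ≤ ((J.erase j).inf A).card :=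
      Finset.card_le_card (Finset.inf_mono (Finset.erase_subset j J))
    rw [← Finset.sum_erase_add _ _ hj] at he
    omega
  let t : ι → ℕ := fun i => if i = j then e else 0
  let d : ι → ℕ := fun i => m - (A i).card - t i
  have htd : ∀ i ∈ J, d i + t i = m - (A i).card := by
    intro i _
    simp only [d, t]
    split_ifs with h
    · subst h; omega
    · omega
  have hsize : ∀ i ∈ J, (A i).card + t i + d i = m := by
    intro i hi
    have := htd i hi
    have := hA i (hJS hi)
    omega
  have hfull : ∑ i ∈ J, d i + (J.inf A).card = m := by
    have h1 := Finset.sum_congr rfl htd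
    have h2 : ∑ i ∈ J, t i = e := by simp [t, hj]
    rw [Finset.sum_add_distrib, h2] at h1
    omega
  refine ⟨J, hJS, hJ1, t, d, ⟨hsize, fun I hI hIne => ?_⟩, hfull⟩
  by_cases h1 : 1 < I.card
  · obtain ⟨i, hi, hij⟩ := hother I h1 j
    refine ⟨i, hi, ?_⟩
    have hti : t i = 0 := by simp [t, hij]
    rw [hti, add_zero]
    rcases eq_or_ne I J with rfl | hIJ
    · exact hfull.le
    · have h2 := hle I hI hIJ hIne
      have h3 : ∑ l ∈ I, d l ≤ ∑ l ∈ I, (m - (A l).card) :=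
        Finset.sum_le_sum fun l _ => Nat.sub_le _ _
      omega
  · obtain ⟨i, rfl⟩ := Finset.card_eq_one.1 (le_antisymm (not_lt.1 h1) hIne.card_pos)
    refine ⟨i, Finset.mem_singleton_self i, ?_⟩
    have := hsize i (hI (Finset.mem_singleton_self i))
    rw [Finset.sum_singleton, Finset.inf_singleton]
    omega

end Selection

/-! ### Cardinality, rate and list-decoding failures of Reed-Solomon codes. -/

section Codes

theorem exists_of_not_isListDecodable {Q : Type*} [DecidableEq Q] {n : ℕ}
    {C : Set (Fin n → Q)} {r : ℝ} {L : ℕ} (h : ¬ IsListDecodable C r L) :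
    ∃ (y : Fin n → Q) (c : Fin (L + 1) → Fin n → Q), Function.Injective c ∧
      ∀ i, c i ∈ C ∧ (hammingDist y (c i) : ℝ) ≤ r * n := by
  rw [IsListDecodable] at h
  push Not at h
  obtain ⟨y, hy⟩ := h
  obtain ⟨T, hT, hcard⟩ := Set.exists_subset_encard_eq (Order.add_one_le_of_lt hy)
  have hcard' : T.encard = ((L + 1 : ℕ) : ℕ∞) := by rw [hcard]; norm_cast
  have hfin : T.Finite := Set.finite_of_encard_eq_coe hcard'
  have hT' : hfin.toFinset.card = L + 1 := by
    rw [hfin.encard_eq_coe_toFinset_card] at hcard'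
    exact_mod_cast hcard'
  let e := (hfin.toFinset.equivFinOfCardEq hT').symm
  refine ⟨y, fun i => (e i : Fin n → Q), Subtype.val_injective.comp e.injective, fun i => ?_⟩
  have hi := hT (hfin.mem_toFinset.1 (e i).2)
  exact ⟨hi.2, hi.1⟩

variable {F : Type*} [Field F] {n k : ℕ}

theorem ncard_rsCode [Fintype F] (hkn : k ≤ n) {α : Fin n → F} (hα : Function.Injective α) :
    (rsCode k α).ncard = Fintype.card F ^ k := by
  have himage : rsCode k α =
      (fun f : F[X] => fun i => f.eval (α i)) '' (degreeLT F k : Set F[X]) := by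
    ext c
    simp only [rsCode, Set.mem_ofPred_eq, Set.mem_image, SetLike.mem_coe, mem_degreeLT]
    exact exists_congr fun f => and_congr_right fun _ =>
      ⟨fun h => funext fun i => (h i).symm, fun h i => (congrFun h i).symm⟩
  rw [himage, Set.InjOn.ncard_image]
  · rw [← Nat.card_coe_set_eq, SetLike.coe_sort_coe,
      Nat.card_congr (degreeLTEquiv F k).toEquiv]
    simp
  · intro f hf g hg hfg
    have hk : (k : WithBot ℕ) ≤ (Finset.univ : Finset (Fin n)).card := by
      rw [Finset.card_univ, Fintype.card_fin]
      exact Nat.cast_le.2 hkn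
    exact eq_of_degrees_lt_of_eval_index_eq (s := Finset.univ) (v := α) hα.injOn
      ((mem_degreeLT.1 hf).trans_le hk) ((mem_degreeLT.1 hg).trans_le hk)
      fun x _ => congrFun hfg x

theorem codeRate_rsCode [Fintype F] (hkn : k ≤ n) {α : Fin n → F}
    (hα : Function.Injective α) : codeRate (rsCode k α) = k / n := by
  have hq : (1 : ℝ) < Fintype.card F := by exact_mod_cast Fintype.one_lt_card
  rw [codeRate, ncard_rsCode hkn hα, Nat.cast_pow, Real.logb_pow,
    Real.logb_self_eq_one hq, mul_one]

/-- With s = √R, the difference of the two radii is (1 - s)(3s - 1)/4, positive for 1/3 < s < 1. -/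
theorem johnsonRadius_lt {R : ℝ} (hR : 1 / 9 < R) (hR1 : R < 1) :
    johnsonRadius R < 3 / 4 * (1 - R) := by
  have h0 : 0 ≤ R := by linarith
  have hs := Real.sq_sqrt h0
  have h1 : 1 / 3 < Real.sqrt R := Real.lt_sqrt_of_sq_lt (by norm_num; linarith)
  have h2 : Real.sqrt R < 1 := by rw [Real.sqrt_lt' one_pos]; linarith
  rw [johnsonRadius]
  nlinarith

/-- A failure of list decoding at radius `(3/4)(1 - R)` yields four distinct polynomials whose
error sets have at most `3 (n - k)` elements in total. -/
theorem exists_errors_of_not_isListDecodable [Fintype F] [DecidableEq F] (hkn : k < n)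
    {α : Fin n → F} (hα : Function.Injective α)
    (h : ¬ IsListDecodable (rsCode k α) (radiusThree (rsCode k α)) 3) :
    ∃ (A : Fin 4 → Finset (Fin n)) (y : Fin n → F) (f : Fin 4 → F[X]),
      Function.Injective f ∧ (∀ i, 4 * (A i).card ≤ 3 * (n - k)) ∧ (∀ i, (f i).degree < k) ∧
        ∀ i, ∀ x, x ∉ A i → (f i).eval (α x) = y x := by
  obtain ⟨y, c, hc, hcC⟩ := exists_of_not_isListDecodable h
  choose f hf hfc using fun i => (hcC i).1
  refine ⟨fun i => Finset.univ.filter fun x => y x ≠ c i x, y, f, fun i i' hii => hc ?_,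
    fun i => ?_, hf, fun i x hx => ?_⟩
  · funext x
    rw [hfc i x, hfc i' x, hii]
  · have h1 := (hcC i).2
    have hn : (n : ℝ) ≠ 0 := Nat.cast_ne_zero.2 (by omega)
    rw [radiusThree, codeRate_rsCode hkn.le hα, mul_assoc, sub_mul, div_mul_cancel₀ _ hn,
      one_mul, ← Nat.cast_sub hkn.le] at h1
    have h2 : (4 * hammingDist y (c i) : ℝ) ≤ 3 * (n - k : ℕ) := by linarith
    exact_mod_cast h2
  · simp only [Finset.mem_filter, Finset.mem_univ, true_and, not_not] at hx
    rw [hx, hfc i x]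

end Codes

/-! ### Certificates for good evaluation vectors and the Schwartz-Zippel count. -/

section Counting

variable {F K : Type*} [Field F] [Field K] {n k : ℕ}

/-- For each choice of error sets, list decoding with these error sets is possible outside of a
hypersurface of bounded degree. -/
theorem exists_certificate_of_errors [Infinite K] (φ : F →+* K) (hkn : k < n)
    (A : Fin 4 → Finset (Fin n)) :
    ∃ D : MvPolynomial (Fin n) K, D ≠ 0 ∧ D.totalDegree ≤ n * n ∧
      ∀ α : Fin n → F, Function.Injective α → MvPolynomial.eval (fun x => φ (α x)) D ≠ 0 →
        ∀ (y : Fin n → F) (f : Fin 4 → F[X]), (∀ i, 4 * (A i).card ≤ 3 * (n - k)) →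
          (∀ i, (f i).degree < k) → (∀ i, ∀ x, x ∉ A i → (f i).eval (α x) = y x) →
            ¬ Function.Injective f := by
  by_cases hA : ∀ i, 4 * (A i).card ≤ 3 * (n - k)
  swap
  · exact ⟨1, one_ne_zero, by simp, fun _ _ _ _ _ h => absurd h hA⟩
  -- The radius 3/4 and the list size 3 enter here: four sets of size at most 3m/4 have codimensions
  -- summing to at least m.
  obtain ⟨J, -, hJ1, t, d, hadm, hfull⟩ := exists_isAdmissible (m := n - k)
    (S := (Finset.univ : Finset (Fin 4))) (A := A) (by simp)
    (fun i _ => by have := hA i; omega) (by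
      rw [Fin.sum_univ_four]
      have h0 := hA 0
      have h1 := hA 1
      have h2 := hA 2
      have h3 := hA 3
      omega)
  obtain ⟨a, ha⟩ := hadm.exists_indepMultiples (K := K) (U := Finset.univ)
    fun i _ => Finset.subset_univ _
  obtain ⟨D, hD, hdeg, hDind⟩ := ha.exists_certificate fun i hi => (hadm.size i hi).le
  refine ⟨D, hD, hdeg.trans ?_, fun α hα hne y f _ hf hy hinj => ?_⟩
  · rw [Fintype.card_fin]
    exact Nat.mul_le_mul_right n (by omega)
  · obtain ⟨i, hi, i', hi', hii⟩ := Finset.one_lt_card.1 hJ1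
    exact hii (hinj ((hDind _ hne).of_map.eq_of_agree hα (Nat.sub_add_cancel hkn.le) hadm.size
      hfull (fun i _ => hf i) (fun i _ => hy i) hi hi'))

/-- The evaluation vectors defining a good code contain the complement of a hypersurface of
bounded degree. -/
theorem exists_certificate_isListDecodable [Fintype F] [DecidableEq F] [Infinite K]
    (φ : F →+* K) (hkn : k < n) :
    ∃ D : MvPolynomial (Fin n) K, D ≠ 0 ∧
      D.totalDegree ≤ n * n + Fintype.card (Fin 4 → Finset (Fin n)) * (n * n) ∧
        ∀ α : Fin n → F, MvPolynomial.eval (fun x => φ (α x)) D ≠ 0 →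
          Function.Injective α ∧ IsListDecodable (rsCode k α) (radiusThree (rsCode k α)) 3 := by
  classical
  choose D hD hdeg hgood using exists_certificate_of_errors (k := k) φ hkn
  -- This factor vanishes exactly when two coordinates coincide.
  let V : MvPolynomial (Fin n) K := ∏ p ∈ (Finset.univ : Finset (Fin n)).offDiag,
    (MvPolynomial.X p.1 - MvPolynomial.X p.2)
  refine ⟨V * ∏ A, D A, mul_ne_zero (Finset.prod_ne_zero_iff.2 fun p hp => sub_ne_zero.2 fun h =>
    (Finset.mem_offDiag.1 hp).2.2 (MvPolynomial.X_injective h))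
      (Finset.prod_ne_zero_iff.2 fun A _ => hD A), ?_, fun α hα => ?_⟩
  · refine (MvPolynomial.totalDegree_mul _ _).trans (add_le_add ?_ ?_)
    · refine (MvPolynomial.totalDegree_finsetProd _ _).trans ?_
      refine (Finset.sum_le_card_nsmul _ _ 1 fun p _ => ?_).trans ?_
      · refine (MvPolynomial.totalDegree_sub _ _).trans ?_
        simp
      · rw [Finset.offDiag_card, Finset.card_univ, Fintype.card_fin, smul_eq_mul, mul_one]
        exact Nat.sub_le _ _
    · refine (MvPolynomial.totalDegree_finsetProd _ _).trans ?_
      exact Finset.sum_le_card_nsmul _ _ _ fun A _ => hdeg A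
  · rw [map_mul, map_prod, map_prod] at hα
    have hV := Finset.prod_ne_zero_iff.1 (left_ne_zero_of_mul hα)
    have hinj : Function.Injective α := by
      intro x z hxz
      by_contra hne
      refine hV (x, z) (by simp [hne]) ?_
      simp [hxz]
    refine ⟨hinj, ?_⟩
    by_contra hld
    obtain ⟨A, y, f, hf, hA, hfk, hy⟩ := exists_errors_of_not_isListDecodable hkn hinj hld
    exact hgood A α hinj
      (Finset.prod_ne_zero_iff.1 (right_ne_zero_of_mul hα) A (Finset.mem_univ A)) y f hA hfk hy hf

/-- Schwartz-Zippel applies over K with the image of F as sampling set, so the coefficients of D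
need not come from F. -/
theorem ncard_setOf_eval_eq_zero_le [Fintype F] (φ : F →+* K) (hn : 0 < n)
    {D : MvPolynomial (Fin n) K} (hD : D ≠ 0) :
    {α : Fin n → F | MvPolynomial.eval (fun x => φ (α x)) D = 0}.ncard ≤
      D.totalDegree * Fintype.card F ^ (n - 1) := by
  classical
  let T : Finset K := Finset.univ.image φ
  have hT : T.card = Fintype.card F := Finset.card_image_of_injective _ φ.injective
  have hq : (0 : ℚ≥0) < Fintype.card F := by exact_mod_cast Fintype.card_pos
  have h := MvPolynomial.schwartz_zippel_totalDegree hD T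
  rw [hT, div_le_iff₀ (pow_pos hq n)] at h
  obtain ⟨n, rfl⟩ := Nat.exists_eq_succ_of_ne_zero hn.ne'
  have h' : ((Finset.filter (fun f => MvPolynomial.eval f D = 0)
      (Fintype.piFinset fun _ => T)).card : ℚ≥0) ≤
        D.totalDegree * (Fintype.card F : ℚ≥0) ^ n := by
    refine h.trans (le_of_eq ?_)
    have hpow : ∀ a b : ℚ≥0, b ≠ 0 → a / b * b ^ (n + 1) = a * b ^ n := fun a b hb => by
      rw [pow_succ]
      field_simp
    exact hpow _ _ hq.ne'
  refine le_trans ?_ (Nat.cast_le.1 (by exact_mod_cast h' : ((Finset.filter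
    (fun f => MvPolynomial.eval f D = 0) (Fintype.piFinset fun _ => T)).card : ℚ≥0) ≤
      (D.totalDegree * Fintype.card F ^ n : ℕ)))
  rw [← Set.ncard_coe_finset]
  refine Set.ncard_le_ncard_of_injOn (fun α x => φ (α x)) (fun α hα => ?_)
    (fun α _ β _ h => funext fun x => φ.injective (congrFun h x)) (Finset.finite_toSet _)
  simp only [Finset.coe_filter, Set.mem_ofPred_eq, Fintype.mem_piFinset]
  exact ⟨fun x => Finset.mem_image_of_mem _ (Finset.mem_univ _), hα⟩

end Counting

/-- The algebraic closure supplies the infinite field needed for generic points, even when F is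
small; the constant depends on n only. -/
theorem ncard_not_injective_and_isListDecodable_le {n k : ℕ} (hkn : k < n)
    (F : Type*) [Field F] [Fintype F] [DecidableEq F] :
    {α : Fin n → F | ¬ (Function.Injective α ∧
        IsListDecodable (rsCode k α) (radiusThree (rsCode k α)) 3)}.ncard ≤
      (n * n + Fintype.card (Fin 4 → Finset (Fin n)) * (n * n)) *
        Fintype.card F ^ (n - 1) := by
  obtain ⟨D, hD, hdeg, hgood⟩ := exists_certificate_isListDecodable (k := k)
    (algebraMap F (AlgebraicClosure F)) hkn
  refine le_trans (Set.ncard_le_ncard ?_ (Set.toFinite _))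
    ((ncard_setOf_eval_eq_zero_le (algebraMap F (AlgebraicClosure F)) (by omega) hD).trans
      (Nat.mul_le_mul_right _ hdeg))
  intro α hα
  by_contra hne
  exact hα (hgood α hne)

/-- If all but `c q ^ (n - 1)` vectors are good, then all but an `O(1/q)` fraction of the
vectors with distinct coordinates are. -/
theorem one_sub_div_mul_ncard_le {n c : ℕ} (hn : 0 < n) {F : Type*} [Fintype F] [Nonempty F]
    {I G : Set (Fin n → F)} (hGI : G ⊆ I) (hG : Gᶜ.ncard ≤ c * Fintype.card F ^ (n - 1)) :
    (1 - ((2 * c : ℕ) : ℝ) / Fintype.card F) * (I.ncard : ℝ) ≤ (G.ncard : ℝ) := by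
  obtain ⟨n, rfl⟩ := Nat.exists_eq_succ_of_ne_zero hn.ne'
  set q : ℝ := (Fintype.card F : ℝ) with hq
  have hq0 : 0 < q := by rw [hq]; exact_mod_cast Fintype.card_pos
  have hG' : (Gᶜ.ncard : ℝ) ≤ c * q ^ n := by rw [hq]; exact_mod_cast hG
  have hGc : (G.ncard : ℝ) + Gᶜ.ncard = q * q ^ n := by
    have h := Set.ncard_add_ncard_compl G
    rw [Nat.card_eq_fintype_card, Fintype.card_fun, Fintype.card_fin, pow_succ'] at h
    rw [hq]
    exact_mod_cast h
  have hI : (I.ncard : ℝ) ≤ G.ncard + Gᶜ.ncard := by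
    rw [hGc]
    have h := Set.ncard_add_ncard_compl I
    rw [Nat.card_eq_fintype_card, Fintype.card_fun, Fintype.card_fin, pow_succ'] at h
    rw [hq]
    exact_mod_cast (by omega : I.ncard ≤ _)
  have hGI' : (G.ncard : ℝ) ≤ I.ncard := by
    exact_mod_cast Set.ncard_le_ncard hGI (Set.toFinite _)
  have hqn : 0 < q ^ n := pow_pos hq0 n
  push_cast
  -- For q ≤ 2c the left side is not positive. Otherwise at least half of all vectors lie in I,
  -- which is why the constant doubles.
  rcases le_total q (2 * c) with hqc | hqc
  · have h1 : 1 - 2 * (c : ℝ) / q ≤ 0 := by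
      rw [sub_nonpos, le_div_iff₀ hq0]
      linarith
    exact (mul_nonpos_of_nonpos_of_nonneg h1 (Nat.cast_nonneg _)).trans (Nat.cast_nonneg _)
  · have h1 : q * q ^ n ≤ 2 * (I.ncard : ℝ) := by nlinarith
    have h2 : (c : ℝ) * q ^ n ≤ 2 * c / q * I.ncard := by
      rw [div_mul_eq_mul_div, le_div_iff₀ hq0]
      have hc : (0 : ℝ) ≤ c := Nat.cast_nonneg c
      nlinarith
    linarith [sub_mul 1 (2 * (c : ℝ) / q) (I.ncard : ℝ)]

end

theorem theorem5 (n k : ℕ) (hk : 0 < k) (hkn : k < n) :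
    -- all but at most `c₃ q ^ (n - 1)` vectors define a good code
    (∃ c₃ : ℕ, ∀ (F : Type u) [Field F] [Fintype F] [DecidableEq F],
      {α : Fin n → F | ¬ (Function.Injective α ∧
          IsListDecodable (rsCode k α) (radiusThree (rsCode k α)) 3)}.ncard
        ≤ c₃ * Fintype.card F ^ (n - 1)) ∧
    -- for rate above `1/9`, all but an `O(1/q)` fraction of the evaluation vectors define a code
    -- that is list-decodable, with lists of size 3, beyond the Johnson radius
    ((1 : ℝ) / 9 < (k : ℝ) / n →
      ∃ c : ℕ, ∀ (F : Type u) [Field F] [Fintype F] [DecidableEq F],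
        (1 - (c : ℝ) / Fintype.card F) * ({α : Fin n → F | Function.Injective α}.ncard : ℝ)
          ≤ ({α : Fin n → F | Function.Injective α ∧
              johnsonRadius (codeRate (rsCode k α)) < radiusThree (rsCode k α) ∧
              IsListDecodable (rsCode k α) (radiusThree (rsCode k α)) 3}.ncard : ℝ)) := by
  refine ⟨⟨_, fun F _ _ _ => ncard_not_injective_and_isListDecodable_le hkn F⟩, fun hR =>
    ⟨2 * (n * n + Fintype.card (Fin 4 → Finset (Fin n)) * (n * n)), fun F _ _ _ =>
      one_sub_div_mul_ncard_le (hk.trans hkn) (fun α hα => hα.1) ?_⟩⟩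
  -- The comparison with the Johnson radius holds for every injective α, so it adds no bad vectors.
  refine le_trans (Set.ncard_le_ncard ?_ (Set.toFinite _))
    (ncard_not_injective_and_isListDecodable_le hkn F)
  intro α hα h
  refine hα ⟨h.1, ?_, h.2⟩
  rw [radiusThree, codeRate_rsCode hkn.le h.1]
  refine johnsonRadius_lt hR ?_
  rw [div_lt_one (by exact_mod_cast hk.trans hkn)]
  exact_mod_cast hkn
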